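/- Let $p$ and $q$ be primes with $p \mid q-1$, let $G$ be a nonabelian group of order $pq$, and let $n \ge 2$. Let $F_n$ be the free group on $a_1,\dots,a_n$. For every sequence $s=(x_1,\dots,x_n)$ of elements that generate $G$, let $\pi_s : F_n \to G$ be the homomorphism with $\pi_s(a_i)=x_i$ for all $i$. Let $K$ be the intersection of the kernels of all these $\pi_s$, and let $H(n,G)=F_n/K$ (the $n$th homogeneous cover of $G$). Then there is a linear action of $\mathbb{Z}_p^n$ on the $\mathbb{F}_q$-vector space $V=\mathbb{F}_q^{(n-1)(p^n-1)}$ such that $$H(n,G)\cong V\rtimes \mathbb{Z}_p^n ,$$ where the semidirect product is formed with this action. There are exactly $p^n-1$ nontrivial homomorphisms $\chi:\mathbb{Z}_p^n\to\mathbb{F}_q^{\times}$, and as an $\mathbb{F}_q\mathbb{Z}_p^n$-module $$V\cong\bigoplus_{\chi\neq 1}\mathbb{F}_q(\chi)^{\,n-1},$$ where $\mathbb{F}_q(\chi)$ is $\mathbb{F}_q$ with $\mathbb{Z}_p^n$ acting through $\chi$; that is, each of the $p^n-1$ nontrivial one-dimensional $\mathbb{F}_q$-representations of $\mathbb{Z}_p^n$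 occurs exactly $n-1$ times. -/

import Mathlib

/-- The set `Γ_n(G)` of generating sequences of length `n` of a group `G`. -/
def generatingSequences (n : ℕ) (G : Type*) [Group G] : Set (Fin n → G) :=
  {s | Subgroup.closure (Set.range s) = ⊤}

/-- The intersection, over all generating sequences `s` of length `n` of `G`, of the kernel of the
homomorphism from the free group on `n` generators `a_i` to `G` that sends `a_i` to `s_i`. (That
kernel depends only on the `Aut(G)`-orbit of `s`, and one representative of each orbit gives the
same intersection.) -/
def coverKernel (n : ℕ) (G : Type*) [Group G] : Subgroup (FreeGroup (Fin n)) :=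
  ⨅ s ∈ generatingSequences n G, (FreeGroup.lift s).ker

instance coverKernel_normal (n : ℕ) (G : Type*) [Group G] : (coverKernel n G).Normal :=
  Subgroup.normal_iInf_normal fun _ => Subgroup.normal_iInf_normal fun _ => inferInstance

/-- The `n`th homogeneous cover `H(n, G)` of a group `G` that is generated by `n` elements. -/
abbrev HomogeneousCover (n : ℕ) (G : Type*) [Group G] : Type :=
  FreeGroup (Fin n) ⧸ coverKernel n G

/-- The action by group automorphisms on the additive group of `V`, written multiplicatively,
that underlies a linear representation on `V`. -/
def repMulAut {k A V : Type*} [Semiring k] [Group A] [AddCommGroup V] [Module k V]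
    (ρ : Representation k A V) : A →* MulAut (Multiplicative V) where
  toFun a :=
    { toFun := fun v => Multiplicative.ofAdd (ρ a v.toAdd)
      invFun := fun v => Multiplicative.ofAdd (ρ a⁻¹ v.toAdd)
      left_inv := fun v => by simp
      right_inv := fun v => by simp
      map_mul' := fun v w => by simp }
  map_one' := by ext v; simp
  map_mul' a b := by ext v; simp

/-- The one-dimensional representation over `k` on which `A` acts through the character `χ`. -/
def charRep {k A : Type*} [CommRing k] [Group A] (χ : A →* kˣ) : Representation k A k where
  toFun a := (χ a : k) • LinearMap.id
  map_one' := by ext; simp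
  map_mul' a b := by ext; simp [mul_comm]

/-! `G` is the subgroup of the affine group over `ℤ/q` whose linear parts are `p`-th roots of unity
(`exists_affineGroup_embedding`). A generating sequence thus gives a nontrivial character `χ` of
`(ℤ/p)^n` and `n` translation parts. Some generator `i₀ χ` has linear part `≠ 1`; conjugating by a
translation makes its translation part `0`, leaving `n - 1` free parameters for each `χ`.

This suggests one universal map from the free group to `V ⋊ (ℤ/p)^n`, with a coordinate of `V` for
each `χ` and each generator other than `i₀ χ`. It is onto (`standardCoverHom_surjective`). Every
`π_s` factors through it up to embedding and conjugation, while its coordinates are themselves of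
the form `π_s`, so its kernel is the intersection (`ker_standardCoverHom`). -/

/-- The group of invertible affine maps `x ↦ u * x + b` of a commutative ring. -/
abbrev AffineGroup (k : Type*) [CommRing k] : Type _ :=
  Multiplicative k ⋊[repMulAut (charRep (MonoidHom.id kˣ))] kˣ

/-! ### Groups of order `pq` as affine groups -/

@[simp]
theorem repMulAut_apply {k A V : Type*} [Semiring k] [Group A] [AddCommGroup V] [Module k V]
    (ρ : Representation k A V) (a : A) (v : Multiplicative V) :
    repMulAut ρ a v = Multiplicative.ofAdd (ρ a v.toAdd) := rfl

@[simp]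
theorem charRep_apply {k A : Type*} [CommRing k] [Group A] (χ : A →* kˣ) (a : A) (x : k) :
    charRep χ a x = χ a * x := rfl

theorem unitsMulAut_bijective (q : ℕ) [Fact q.Prime] :
    Function.Bijective (repMulAut (charRep (MonoidHom.id (ZMod q)ˣ))) := by
  refine ⟨fun u v h => ?_, fun f => ?_⟩
  · have := congrArg (fun g => (g (Multiplicative.ofAdd 1)).toAdd) h
    exact Units.ext (by simpa using this)
  · have hf : ∀ x : ZMod q, f (.ofAdd x) = .ofAdd ((f (.ofAdd 1)).toAdd * x) := fun x => by
      obtain ⟨m, rfl⟩ := ZMod.natCast_zmod_surjective x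
      have : (Multiplicative.ofAdd (m : ZMod q)) = .ofAdd (1 : ZMod q) ^ m := by
        rw [← ofAdd_nsmul]; simp
      rw [this, map_pow]
      apply Multiplicative.toAdd.injective
      simp [mul_comm]
    have hne : (f (.ofAdd 1)).toAdd ≠ 0 := fun h => by
      have h1 : f (.ofAdd 1) = f 1 := by
        rw [map_one f]; exact Multiplicative.toAdd.injective h
      have h2 := congrArg Multiplicative.toAdd (f.injective h1)
      simp at h2
    refine ⟨Units.mk0 _ hne, MulEquiv.ext fun x => ?_⟩
    rw [repMulAut_apply, charRep_apply]
    exact (hf x.toAdd).symm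

/-- A subgroup of order `q` has the smallest prime divisor as index, so it is normal, and a subgroup
of order `p` complements it. The conjugation action is nontrivial since `G` is nonabelian, hence
faithful since `p` is prime. -/
theorem exists_affineGroup_embedding {p q : ℕ} (hp : p.Prime) (hq : q.Prime) (hpq : p ∣ q - 1)
    {G : Type*} [Group G] (hG : Nat.card G = p * q) (hna : ¬ ∀ x y : G, x * y = y * x) :
    ∃ ι : G →* AffineGroup (ZMod q), Function.Injective ι ∧
      ∀ t, t ∈ ι.range ↔ t.right ^ p = 1 := by
  have := Fact.mk hp
  have := Fact.mk hq
  have hlt : p < q := by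
    have := Nat.le_of_dvd (by have := hq.two_le; omega) hpq
    have := hq.two_le; omega
  have : Finite G := Nat.finite_of_card_ne_zero (by rw [hG]; exact (Nat.mul_pos hp.pos hq.pos).ne')
  obtain ⟨y, hy⟩ := exists_prime_orderOf_dvd_card' (G := G) q (by rw [hG]; exact dvd_mul_left _ _)
  obtain ⟨g, hg⟩ := exists_prime_orderOf_dvd_card' (G := G) p (by rw [hG]; exact dvd_mul_right _ _)
  set H := Subgroup.zpowers y with hH
  set K := Subgroup.zpowers g with hK
  have cH : Nat.card H = q := by rw [hH, Nat.card_zpowers, hy]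
  have cK : Nat.card K = p := by rw [hK, Nat.card_zpowers, hg]
  have hHn : H.Normal := by
    apply Subgroup.normal_of_index_eq_minFac_card
    have h1 := H.index_mul_card
    rw [cH, hG] at h1
    rw [Nat.eq_of_mul_eq_mul_right hq.pos h1, hG]
    refine le_antisymm ?_ (Nat.minFac_le_of_dvd hp.two_le (dvd_mul_right _ _))
    have hm : (p * q).minFac.Prime := Nat.minFac_prime (fun h => by
      have := hp.two_le; have := hq.two_le; nlinarith)
    rcases (Nat.Prime.dvd_mul hm).1 (Nat.minFac_dvd _) with h | h
    · exact ((Nat.prime_dvd_prime_iff_eq hm hp).1 h).ge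
    · exact hlt.le.trans ((Nat.prime_dvd_prime_iff_eq hm hq).1 h).ge
  have hc : H.IsComplement' K := Subgroup.isComplement'_of_coprime
    (by rw [cH, cK, hG, mul_comm]) (by
      rw [cH, cK]; exact ((Nat.coprime_primes hp hq).2 hlt.ne).symm)
  let E := SemidirectProduct.mulEquivSubgroup hc
  set φ := (H.normalizerMonoidHom).comp (Subgroup.inclusion (H.normalizer_eq_top ▸ le_top : K ≤ _))
  let e : H ≃* Multiplicative (ZMod q) := mulEquivOfPrimeCardEq (p := q) cH (by simp)
  let U := MulEquiv.ofBijective _ (unitsMulAut_bijective q)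
  let ψ : K →* (ZMod q)ˣ := U.symm.toMonoidHom.comp ((MulAut.congr e).toMonoidHom.comp φ)
  have hψ : ∀ k, repMulAut (charRep (MonoidHom.id (ZMod q)ˣ)) (ψ k) = MulAut.congr e (φ k) :=
    fun k => U.apply_symm_apply _
  have hφ1 : φ ≠ 1 := fun h => by
    apply hna
    have hHc : ∀ a b : H, a * b = b * a := fun a b => e.injective (by simp [mul_comm])
    have hKc : ∀ a b : K, a * b = b * a := fun a b => mul_comm' a b
    have hT : ∀ a b : H ⋊[φ] K, a * b = b * a := fun a b => by
      ext
      · simp [h, hHc a.left b.left]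
      · simp [hKc a.right b.right]
    intro a b
    exact E.symm.injective (by rw [map_mul, map_mul, hT])
  have hψi : Function.Injective ψ := by
    have hφi : Function.Injective φ := by
      rw [← MonoidHom.ker_eq_bot_iff]
      have : Fact (Nat.card K).Prime := ⟨by rwa [cK]⟩
      refine φ.ker.eq_bot_or_eq_top_of_prime_card.resolve_right fun h => hφ1 ?_
      exact MonoidHom.ker_eq_top_iff.1 h
    exact U.symm.injective.comp ((MulAut.congr e).injective.comp hφi)
  -- The range has `p` elements, and a field has at most `p` such roots.
  have hrange : ψ.range = rootsOfUnity p (ZMod q) := by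
    apply Subgroup.eq_of_le_of_card_ge
    · rintro _ ⟨k, rfl⟩
      rw [mem_rootsOfUnity, ← map_pow, ← cK, pow_card_eq_one', map_one]
    · rw [← Nat.card_congr (MonoidHom.ofInjective hψi).toEquiv, cK]
      exact card_rootsOfUnity _ _
  let M : H ⋊[φ] K →* AffineGroup (ZMod q) := SemidirectProduct.map e.toMonoidHom ψ (fun k => by
    rw [hψ]; ext x; simp)
  refine ⟨M.comp E.symm.toMonoidHom, ?_, fun t => ⟨?_, fun ht => ?_⟩⟩
  · refine Function.Injective.comp (g := M) (fun a b h => ?_) E.symm.injective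
    ext1
    · exact e.injective (congrArg (fun t => t.left) h)
    · exact hψi (congrArg (fun t => t.right) h)
  · rintro ⟨x, rfl⟩
    exact (hrange.le ⟨(E.symm x).right, rfl⟩ : _ ∈ rootsOfUnity p _)
  · obtain ⟨k, hk⟩ := hrange.ge (show t.right ∈ rootsOfUnity p _ from ht)
    refine ⟨E ⟨e.symm t.left, k⟩, ?_⟩
    ext1
    · simp [M]
    · simp [M, hk]

/-! ### Diagonal representations and characters of `(ℤ/p)^n` -/

/-- The representation on functions `J → k` on which `A` acts on the coordinate `j` through the
character `χ j`. -/
def diagRep {k A J : Type*} [CommRing k] [Group A] (χ : J → A →* kˣ) :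
    Representation k A (J → k) where
  toFun a := LinearMap.pi fun j => (χ j a : k) • LinearMap.proj j
  map_one' := by ext; simp
  map_mul' a b := by ext; simp [mul_assoc]

@[simp]
theorem diagRep_apply {k A J : Type*} [CommRing k] [Group A] (χ : J → A →* kˣ) (a : A)
    (v : J → k) (j : J) : diagRep χ a v j = χ j a * v j := rfl

/-- The `i`th standard generator of `(ℤ/p)^n`, written multiplicatively. -/
abbrev stdGen (p n : ℕ) (i : Fin n) : Multiplicative (Fin n → ZMod p) :=
  Multiplicative.ofAdd (Pi.single i 1)

theorem closure_range_stdGen (p n : ℕ) [NeZero p] :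
    Subgroup.closure (Set.range (stdGen p n)) = ⊤ := by
  refine (Subgroup.eq_top_iff' _).2 fun a => ?_
  have : a = ∏ i, stdGen p n i ^ (a.toAdd i).val := by
    apply Multiplicative.toAdd.injective
    rw [toAdd_prod]
    ext j
    simp only [toAdd_pow, toAdd_ofAdd, Finset.sum_apply]
    rw [Finset.sum_eq_single j]
    · rw [Pi.smul_apply, Pi.single_eq_same, nsmul_eq_mul, mul_one, ZMod.natCast_zmod_val]
    · intro i _ hi
      rw [Pi.smul_apply, Pi.single_eq_of_ne hi.symm, smul_zero]
    · simp
  rw [this]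
  exact Subgroup.prod_mem _ fun i _ =>
    Subgroup.pow_mem _ (Subgroup.subset_closure (Set.mem_range_self i)) _

theorem hom_ext_stdGen {p n : ℕ} [NeZero p] {M : Type*} [Group M]
    {f g : Multiplicative (Fin n → ZMod p) →* M}
    (h : ∀ i, f (stdGen p n i) = g (stdGen p n i)) : f = g := by
  refine MonoidHom.eq_of_eqOn_dense (closure_range_stdGen p n) ?_
  rintro _ ⟨i, rfl⟩
  exact h i

theorem exists_hom_stdGen {p n : ℕ} {M : Type*} [CommGroup M] (c : Fin n → M)
    (hc : ∀ i, c i ^ p = 1) :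
    ∃ f : Multiplicative (Fin n → ZMod p) →* M, ∀ i, f (stdGen p n i) = c i := by
  let f (i : Fin n) : ZMod p →+ Additive M :=
    ZMod.lift p ⟨zmultiplesHom _ (Additive.ofMul (c i)), by
      simpa using congrArg Additive.ofMul (hc i)⟩
  have hf (i : Fin n) : f i 1 = Additive.ofMul (c i) := by
    have := ZMod.lift_coe p ⟨zmultiplesHom _ (Additive.ofMul (c i)), by
      simpa using congrArg Additive.ofMul (hc i)⟩ 1
    simpa [f] using this
  let g : (Fin n → ZMod p) →+ Additive M :=
    ∑ i, (f i).comp (Pi.evalAddMonoidHom (fun _ => ZMod p) i)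
  refine ⟨AddMonoidHom.toMultiplicativeLeft g, fun i => ?_⟩
  change (g (Pi.single i 1)).toMul = c i
  have : g (Pi.single i 1) = Additive.ofMul (c i) := by
    rw [AddMonoidHom.finsetSum_apply, Finset.sum_eq_single i]
    · simp [hf]
    · intro j _ hj
      simp [hj]
    · simp
  rw [this]; rfl

theorem hasEnoughRootsOfUnity_zmod {p q : ℕ} (hq : q.Prime) (hpq : p ∣ q - 1) (n : ℕ) :
    HasEnoughRootsOfUnity (ZMod q) (Monoid.exponent (Multiplicative (Fin n → ZMod p))) := by
  have := Fact.mk hq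
  have : NeZero (q - 1) := ⟨by have := hq.two_le; omega⟩
  refine HasEnoughRootsOfUnity.of_dvd (ZMod q) (n := q - 1) (dvd_trans ?_ hpq)
  refine Monoid.exponent_dvd_of_forall_pow_eq_one fun a => ?_
  apply Multiplicative.toAdd.injective
  ext j
  simp

theorem natCard_nontrivial_chars {p q : ℕ} (hp : p.Prime) (hq : q.Prime) (hpq : p ∣ q - 1)
    (n : ℕ) :
    Nat.card {χ : Multiplicative (Fin n → ZMod p) →* (ZMod q)ˣ // χ ≠ 1} = p ^ n - 1 := by
  have := hasEnoughRootsOfUnity_zmod hq hpq n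
  have := Fact.mk hp
  have h := CommGroup.card_monoidHom_of_hasEnoughRootsOfUnity
    (Multiplicative (Fin n → ZMod p)) (ZMod q)
  have : Finite (Multiplicative (Fin n → ZMod p) →* (ZMod q)ˣ) :=
    Nat.finite_of_card_ne_zero (by rw [h]; exact Nat.card_pos.ne')
  have hs := Set.ncard_compl ({1} : Set (Multiplicative (Fin n → ZMod p) →* (ZMod q)ˣ))
  rw [Set.ncard_singleton, h] at hs
  change Set.ncard {χ : Multiplicative (Fin n → ZMod p) →* (ZMod q)ˣ | χ ≠ 1} = _
  refine hs.trans ?_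
  simp

/-! ### Surjectivity onto the semidirect product -/

section Cover

variable {p q n : ℕ} {J : Type*}

/-- The homomorphism from the free group to the semidirect product that lifts the standard
generators of `(ℤ/p)^n` with the vectors `v i` as first components. -/
def coverHom (χ : J → Multiplicative (Fin n → ZMod p) →* (ZMod q)ˣ)
    (v : Fin n → J → ZMod q) :
    FreeGroup (Fin n) →* Multiplicative (J → ZMod q) ⋊[repMulAut (diagRep χ)]
      Multiplicative (Fin n → ZMod p) :=
  FreeGroup.lift fun i => ⟨Multiplicative.ofAdd (v i), stdGen p n i⟩

@[simp]
theorem coverHom_of (χ : J → Multiplicative (Fin n → ZMod p) →* (ZMod q)ˣ)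
    (v : Fin n → J → ZMod q) (i : Fin n) :
    coverHom χ v (FreeGroup.of i) = ⟨Multiplicative.ofAdd (v i), stdGen p n i⟩ := by
  simp [coverHom]

/-- An equivariant linear functional induces a homomorphism to the affine group. -/
def toAffineGroup {k A V : Type*} [CommRing k] [Group A] [AddCommGroup V] [Module k V]
    {ρ : Representation k A V} (χ : A →* kˣ) (l : V →ₗ[k] k) (h : ∀ a v, l (ρ a v) = χ a * l v) :
    Multiplicative V ⋊[repMulAut ρ] A →* AffineGroup k :=
  SemidirectProduct.map (AddMonoidHom.toMultiplicative l.toAddMonoidHom) χ fun a => by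
    refine MonoidHom.ext fun v => ?_
    exact congrArg Multiplicative.ofAdd (h a (Multiplicative.toAdd v))

/-- The image meets the vector part in a submodule, which contains the commutator vectors of the
generators. By `hv`, the `χ j`-isotypic part of one of these is a nonzero multiple of the `j`th
basis vector, and averaging against `χ j` extracts it. -/
theorem coverHom_surjective [NeZero p] [Fact q.Prime] (hpq : p.Coprime q) [Finite J] [DecidableEq J]
    (χ : J → Multiplicative (Fin n → ZMod p) →* (ZMod q)ˣ) (v : Fin n → J → ZMod q)
    (hv : ∀ j, ∃ i i', χ j (stdGen p n i) ≠ 1 ∧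
      ∀ j', χ j' = χ j → v i j' = 0 ∧ v i' j' = (Pi.single j 1 : J → ZMod q) j') :
    Function.Surjective (coverHom χ v) := by
  have := Fintype.ofFinite J
  set R := (coverHom χ v).range
  have hgen (i) : (⟨Multiplicative.ofAdd (v i), stdGen p n i⟩ : _ ⋊[_] _) ∈ R :=
    ⟨FreeGroup.of i, coverHom_of χ v i⟩
  have hright (a : Multiplicative (Fin n → ZMod p)) : ∃ r ∈ R, r.right = a := by
    have : R.map SemidirectProduct.rightHom = ⊤ := by
      rw [eq_top_iff, ← closure_range_stdGen, Subgroup.closure_le]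
      rintro _ ⟨i, rfl⟩
      exact ⟨_, hgen i, rfl⟩
    exact (this.ge (Subgroup.mem_top a) :)
  let N : Submodule (ZMod q) (J → ZMod q) := AddSubgroup.toZModSubmodule q
    (Subgroup.toAddSubgroup' (R.comap SemidirectProduct.inl))
  have hN (x : J → ZMod q) : x ∈ N ↔ SemidirectProduct.inl (Multiplicative.ofAdd x) ∈ R := Iff.rfl
  have hstab (a) (x : J → ZMod q) (hx : x ∈ N) : diagRep χ a x ∈ N := by
    obtain ⟨r, hr, rfl⟩ := hright a
    rw [hN] at hx ⊢
    convert R.mul_mem (R.mul_mem hr hx) (R.inv_mem hr) using 1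
    rw [eq_mul_inv_iff_mul_eq]
    ext1
    · simp [mul_comm]
    · simp
  have hcomm (i i') : diagRep χ (stdGen p n i) (v i') - v i' -
      (diagRep χ (stdGen p n i') (v i) - v i) ∈ N := by
    rw [hN]
    convert R.mul_mem (R.mul_mem (hgen i) (hgen i'))
      (R.inv_mem (R.mul_mem (hgen i') (hgen i))) using 1
    rw [eq_mul_inv_iff_mul_eq]
    ext1
    · apply Multiplicative.toAdd.injective
      simp only [SemidirectProduct.mul_left, SemidirectProduct.left_inl,
        SemidirectProduct.right_inl, map_one, MulAut.one_apply, repMulAut_apply, toAdd_mul,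
        toAdd_ofAdd]
      abel
    · simp only [SemidirectProduct.mul_right, SemidirectProduct.right_inl, one_mul, mul_comm]
  have hsingle (j) : Pi.single j 1 ∈ N := by
    obtain ⟨i, i', hi, hb⟩ := hv j
    set w := diagRep χ (stdGen p n i) (v i') - v i' -
      (diagRep χ (stdGen p n i') (v i) - v i)
    have hw (j') (h : χ j' = χ j) :
        w j' = (χ j (stdGen p n i) - 1) * (Pi.single j 1 : J → ZMod q) j' := by
      obtain ⟨h1, h2⟩ := hb j' h
      simp only [w, Pi.sub_apply, diagRep_apply, h1, h2, h]
      ring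
    -- The sum over the group is `p ^ n` times the projection to the `χ j`-isotypic part; other
    -- characters cancel by orthogonality.
    have hsum : ∑ a, ((χ j a)⁻¹ : (ZMod q)ˣ).val • diagRep χ a w =
        ((p : ZMod q) ^ n * (χ j (stdGen p n i) - 1)) • Pi.single j 1 := by
      ext j'
      rw [Finset.sum_apply]
      simp only [Pi.smul_apply, diagRep_apply, smul_eq_mul]
      by_cases h : χ j' = χ j
      · rw [h, hw j' h]
        simp only [← mul_assoc, Units.inv_mul, one_mul]
        simp [mul_assoc]
      · have hne : j' ≠ j := fun h' => h (by rw [h'])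
        have hs := sum_hom_units_eq_zero ((Units.coeHom (ZMod q)).comp ((χ j)⁻¹ * χ j'))
          fun h' => h (MonoidHom.ext fun a => by
            have h1 : ((χ j)⁻¹ * χ j') a = 1 := Units.ext (DFunLike.congr_fun h' a)
            exact (inv_mul_eq_one.1 h1).symm)
        have hs' : ∑ a, ((χ j a)⁻¹ : (ZMod q)ˣ).val * (χ j' a : ZMod q) = 0 := hs
        simp only [← mul_assoc, ← Finset.sum_mul]
        rw [hs', Pi.single_eq_of_ne hne, zero_mul, mul_zero]
    have hunit : (p : ZMod q) ^ n * (χ j (stdGen p n i) - 1) ≠ 0 := by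
      refine mul_ne_zero (pow_ne_zero _ fun h => ?_) (sub_ne_zero.2 fun h => hi (Units.ext h))
      rw [ZMod.natCast_eq_zero_iff] at h
      exact (Fact.out : q.Prime).one_lt.ne' (Nat.Coprime.eq_one_of_dvd hpq.symm h)
    rw [← N.smul_mem_iff hunit, ← hsum]
    exact N.sum_mem fun a _ => N.smul_mem _ (hstab a w (hcomm i i'))
  have hall (x : J → ZMod q) : x ∈ N := by
    rw [← LinearMap.sum_single_apply (fun _ => ZMod q) x]
    refine N.sum_mem fun j _ => ?_
    have := N.smul_mem (x j) (hsingle j)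
    rwa [← Pi.single_smul', smul_eq_mul, mul_one] at this
  intro t
  obtain ⟨r, hr, hrt⟩ := hright t.right
  suffices h : t * r⁻¹ ∈ R by
    exact (R.mul_mem_cancel_right (R.inv_mem hr)).1 h
  have : t * r⁻¹ = SemidirectProduct.inl (t * r⁻¹).left := by
    ext1
    · rfl
    · simp [hrt]
  rw [this]
  exact hall _

end Cover

/-! ### The kernel of the universal map -/

/-- The nontrivial homomorphisms from `(ℤ/p)^n` to the units of `ℤ/q`. -/
abbrev NontrivialChar (p q n : ℕ) : Type :=
  {χ : Multiplicative (Fin n → ZMod p) →* (ZMod q)ˣ // χ ≠ 1}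

section Kernel

variable {p q m : ℕ} {J : Type*}

/-- The first components of the lifted generators: for the index `j` that corresponds to the pair
`(χ, k)`, the `k`th of the generators other than `i₀ χ` has coordinate `1` at `j`, and the
others have coordinate `0`. -/
def coverVec {X : Type*} (e : J ≃ X × Fin m) (i₀ : X → Fin (m + 1)) (i : Fin (m + 1)) (j : J) :
    ZMod q :=
  if i = (i₀ (e j).1).succAbove (e j).2 then 1 else 0

variable
  (e : J ≃ NontrivialChar p q (m + 1) × Fin m)
  (i₀ : NontrivialChar p q (m + 1) → Fin (m + 1))

/-- The homomorphism to the semidirect product given by the vectors `coverVec`. -/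
abbrev standardCoverHom :
    FreeGroup (Fin (m + 1)) →*
      Multiplicative (J → ZMod q) ⋊[repMulAut (diagRep fun j => (e j).1.1)]
        Multiplicative (Fin (m + 1) → ZMod p) :=
  coverHom (fun j => (e j).1.1) (coverVec e i₀)

theorem standardCoverHom_surjective [NeZero p] [Fact q.Prime] (hpq : p.Coprime q) [Finite J]
    (h₀ : ∀ χ : NontrivialChar p q (m + 1), χ.1 (stdGen p (m + 1) (i₀ χ)) ≠ 1) :
    Function.Surjective (standardCoverHom e i₀) := by
  classical
  refine coverHom_surjective hpq _ _ fun j =>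
    ⟨i₀ (e j).1, (i₀ (e j).1).succAbove (e j).2, h₀ _, fun j' h => ?_⟩
  have h' : (e j').1 = (e j).1 := Subtype.ext h
  have hj : (e j).2 = (e j').2 ↔ j' = j := by
    rw [← e.injective.eq_iff, Prod.ext_iff]
    simp [h', eq_comm]
  constructor
  · simp [coverVec, h', (Fin.succAbove_ne _ _).symm]
  · simp [coverVec, h', Pi.single_apply, hj]

/-- Up to conjugation by a translation, `θ` factors through the universal map: its translation parts
are the coefficients of a functional on the `χ`-isotypic coordinates. -/
theorem eq_one_of_standardCoverHom_eq_one [NeZero p] [Fact q.Prime]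
    (h₀ : ∀ χ : NontrivialChar p q (m + 1), χ.1 (stdGen p (m + 1) (i₀ χ)) ≠ 1)
    (θ : FreeGroup (Fin (m + 1)) →* AffineGroup (ZMod q))
    (hθ : ∀ i, (θ (FreeGroup.of i)).right ^ p = 1)
    (hne : ∃ i, (θ (FreeGroup.of i)).right ≠ 1)
    {w : FreeGroup (Fin (m + 1))} (hw : standardCoverHom e i₀ w = 1) : θ w = 1 := by
  obtain ⟨χ, hχ⟩ := exists_hom_stdGen (fun i => (θ (FreeGroup.of i)).right) hθ
  have hχ1 : χ ≠ 1 := by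
    rintro rfl
    obtain ⟨i, hi⟩ := hne
    exact hi (hχ i).symm
  set x : NontrivialChar p q (m + 1) := ⟨χ, hχ1⟩
  set u : ZMod q := (χ (stdGen p (m + 1) (i₀ x)) : ZMod q)
  have hu : u - 1 ≠ 0 := sub_ne_zero.2 fun h => h₀ x (Units.ext h)
  set b : ZMod q := (θ (FreeGroup.of (i₀ x))).left.toAdd
  -- The map `x ↦ u * x + b` fixes `-b / (u - 1)`; this translation moves the fixed point to `0`.
  let t : AffineGroup (ZMod q) := SemidirectProduct.inl (Multiplicative.ofAdd (b / (u - 1)))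
  let θ' := (MulAut.conj t).toMonoidHom.comp θ
  let d (i : Fin (m + 1)) : ZMod q := (θ' (FreeGroup.of i)).left.toAdd
  have hd (i) : d i = b / (u - 1) + (θ (FreeGroup.of i)).left.toAdd -
      χ (stdGen p (m + 1) i) * (b / (u - 1)) := by
    simp [d, θ', t, hχ, sub_eq_add_neg]
  have hd₀ : d (i₀ x) = 0 := by
    rw [hd]
    change b / (u - 1) + b - u * (b / (u - 1)) = 0
    field_simp
    ring
  let l : (J → ZMod q) →ₗ[ZMod q] ZMod q :=
    ∑ k, d ((i₀ x).succAbove k) • LinearMap.proj (e.symm (x, k))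
  have hl (v : J → ZMod q) : l v = ∑ k, d ((i₀ x).succAbove k) * v (e.symm (x, k)) := by
    simp [l]
  have hlρ (a) (v : J → ZMod q) : l (diagRep (fun j => (e j).1.1) a v) = χ a * l v := by
    rw [hl, hl, Finset.mul_sum]
    refine Finset.sum_congr rfl fun k _ => ?_
    rw [diagRep_apply, Equiv.apply_symm_apply]
    ring
  have key : θ' = (toAffineGroup χ l hlρ).comp (standardCoverHom e i₀) := by
    refine FreeGroup.ext_hom _ _ fun i => ?_
    have hi : (toAffineGroup χ l hlρ).comp (standardCoverHom e i₀) (FreeGroup.of i) =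
        toAffineGroup χ l hlρ ⟨Multiplicative.ofAdd (coverVec e i₀ i), stdGen p (m + 1) i⟩ :=
      congrArg (toAffineGroup χ l hlρ) (coverHom_of (fun j => (e j).1.1) (coverVec e i₀) i)
    rw [hi]
    ext1
    · apply Multiplicative.toAdd.injective
      change d i = l (coverVec e i₀ i)
      rw [hl]
      rcases Fin.eq_self_or_eq_succAbove (i₀ x) i with rfl | ⟨k, rfl⟩
      · simp [coverVec, hd₀, (Fin.succAbove_ne _ _).symm]
      · simp [coverVec]
    · change (θ' (FreeGroup.of i)).right = χ (stdGen p (m + 1) i)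
      simp [θ', t, hχ]
  have h1 : θ' w = 1 := by
    rw [key, MonoidHom.comp_apply, hw, map_one]
  exact (MulAut.conj t).injective (h1.trans (map_one _).symm)

/-- Every proper subgroup has order `1`, `p` or `q`, so it is cyclic. -/
theorem closure_eq_top_of_not_commute {p q : ℕ} (hp : p.Prime) (hq : q.Prime) {G : Type*}
    [Group G] (hG : Nat.card G = p * q) {s : Set G} {x y : G} (hx : x ∈ s) (hy : y ∈ s)
    (hxy : x * y ≠ y * x) : Subgroup.closure s = ⊤ := by
  have : Finite G := Nat.finite_of_card_ne_zero (by rw [hG]; exact (Nat.mul_pos hp.pos hq.pos).ne')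
  set H := Subgroup.closure s
  have hcyc : ¬ IsCyclic H := fun h => by
    have := mul_comm' (⟨x, Subgroup.subset_closure hx⟩ : H) ⟨y, Subgroup.subset_closure hy⟩
    exact hxy (congrArg Subtype.val this)
  apply Subgroup.eq_top_of_card_eq
  have hd : Nat.card H ∣ p * q := hG ▸ H.card_subgroup_dvd_card
  obtain ⟨a, b, ha, hb, hab⟩ := exists_dvd_and_dvd_of_dvd_mul hd
  have := Fact.mk hp
  have := Fact.mk hq
  rcases (Nat.dvd_prime hp).1 ha with rfl | rfl <;> rcases (Nat.dvd_prime hq).1 hb with rfl | rfl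
  · have := (Nat.card_eq_one_iff_unique.1 hab).1
    exact absurd isCyclic_of_subsingleton hcyc
  · exact absurd (isCyclic_of_prime_card (p := b) (by rw [hab, one_mul])) hcyc
  · exact absurd (isCyclic_of_prime_card (p := a) (by rw [hab, mul_one])) hcyc
  · rw [hab, hG]

theorem ker_standardCoverHom (hp : p.Prime) (hq : q.Prime) (hpq : p ∣ q - 1) (hm : 0 < m)
    {G : Type*} [Group G] (hG : Nat.card G = p * q) (hna : ¬ ∀ x y : G, x * y = y * x)
    (h₀ : ∀ χ : NontrivialChar p q (m + 1), χ.1 (stdGen p (m + 1) (i₀ χ)) ≠ 1) :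
    (standardCoverHom e i₀).ker = coverKernel (m + 1) G := by
  have := Fact.mk hp
  have := Fact.mk hq
  obtain ⟨ι, hι, hr⟩ := exists_affineGroup_embedding hp hq hpq hG hna
  ext w
  simp only [coverKernel, Subgroup.mem_iInf, MonoidHom.mem_ker]
  refine ⟨fun hw s hs => ?_, fun hw => ?_⟩
  · apply hι
    rw [map_one]
    refine eq_one_of_standardCoverHom_eq_one e i₀ h₀ (ι.comp (FreeGroup.lift s))
      (fun i => (hr _).1 ⟨_, rfl⟩) ?_ hw
    -- If all linear parts were trivial, `G` would embed in the translations and be abelian.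
    by_contra! hc
    apply hna
    have h1 : SemidirectProduct.rightHom.comp ι = 1 := by
      refine MonoidHom.eq_of_eqOn_dense hs ?_
      rintro _ ⟨i, rfl⟩
      simpa using hc i
    intro a b
    apply hι
    have h2 (a : G) : (ι a).right = 1 := DFunLike.congr_fun h1 a
    ext1
    · simp [h2, mul_comm]
    · simp [h2]
  · have key (j : J) : ((standardCoverHom e i₀ w).left.toAdd j = 0) ∧
        (e j).1.1 (standardCoverHom e i₀ w).right = 1 := by
      let T := toAffineGroup (ρ := diagRep fun j => (e j).1.1) (e j).1.1
        (LinearMap.proj j : (J → ZMod q) →ₗ[ZMod q] ZMod q) (fun a v => rfl)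
      have hT (t) : (T t).right = (e j).1.1 t.right := rfl
      have hT' (t) : (T t).left = Multiplicative.ofAdd (t.left.toAdd j) := rfl
      have hex (i) : ∃ g, ι g = T (standardCoverHom e i₀ (FreeGroup.of i)) := by
        refine (hr _).2 ?_
        rw [hT, ← map_pow, ← map_one (e j).1.1]
        congr 1
        apply Multiplicative.toAdd.injective
        ext i
        simp
      choose s hs using hex
      have hcomp : ι.comp (FreeGroup.lift s) = T.comp (standardCoverHom e i₀) :=
        FreeGroup.ext_hom _ _ fun i => by
          rw [MonoidHom.comp_apply, FreeGroup.lift_apply_of, hs, MonoidHom.comp_apply]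
      have hgen : s ∈ generatingSequences (m + 1) G := by
        -- The images `x ↦ u * x` with `u ≠ 1` and `x ↦ u' * x + 1` do not commute.
        refine closure_eq_top_of_not_commute hp hq hG
          (Set.mem_range_self (i₀ (e j).1))
          (Set.mem_range_self ((i₀ (e j).1).succAbove (e j).2)) fun h => ?_
        have h' := congrArg (fun g => (ι g).left.toAdd) h
        simp only [map_mul, hs, coverHom_of] at h'
        simp [hT, hT', coverVec, (Fin.succAbove_ne _ _).symm] at h'
        exact h₀ _ h'
      have hw' := DFunLike.congr_fun hcomp w
      simp only [MonoidHom.comp_apply] at hw'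
      rw [hw s hgen, map_one] at hw'
      exact ⟨(congrArg (fun t => t.left.toAdd) hw').symm, (congrArg (fun t => t.right) hw').symm⟩
    ext1
    · exact Multiplicative.toAdd.injective (funext fun j => (key j).1)
    · by_contra hne
      have := hasEnoughRootsOfUnity_zmod hq hpq (m + 1)
      obtain ⟨φ, hφ⟩ := CommGroup.exists_apply_ne_one_of_hasEnoughRootsOfUnity _ (ZMod q) hne
      -- A nontrivial character indexes a coordinate only because `0 < m`, that is, `n ≥ 2`.
      have := (key (e.symm (⟨φ, fun h => hφ (by rw [h]; rfl)⟩, ⟨0, hm⟩))).2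
      rw [Equiv.apply_symm_apply] at this
      exact hφ this

end Kernel

/-! ### Decomposition into characters and conclusion -/

/-- The diagonal representation is the direct sum of its characters. -/
theorem nonempty_diagRep_equiv_directSum {k A J I : Type*} [CommRing k] [Group A] [Finite I]
    (e : J ≃ I) (χ : I → A →* kˣ) :
    Nonempty ((diagRep fun j => χ (e j)).Equiv
      (Representation.directSum fun i => charRep (χ i))) := by
  classical
  have := Fintype.ofFinite I
  refine ⟨Representation.Equiv.mk ((LinearEquiv.funCongrLeft k k e.symm).trans
    (DirectSum.linearEquivFunOnFintype k I fun _ => k).symm) fun a => ?_⟩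
  refine LinearMap.ext fun v => ?_
  apply (DirectSum.linearEquivFunOnFintype k I fun _ => k).injective
  ext i
  have hsymm (f : I → k) (i : I) :
      (DirectSum.linearEquivFunOnFintype k I fun _ => k).symm f i = f i :=
    congrFun (LinearEquiv.apply_symm_apply (DirectSum.linearEquivFunOnFintype k I fun _ => k) f) i
  refine (hsymm (LinearEquiv.funCongrLeft k k e.symm (diagRep (fun j => χ (e j)) a v)) i).trans ?_
  refine Eq.trans ?_
    (congrArg (charRep (χ i) a) (hsymm (LinearEquiv.funCongrLeft k k e.symm v) i)).symm
  simp [LinearMap.funLeft_apply]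

theorem proposition9p3 (p q n : ℕ) (hp : p.Prime) (hq : q.Prime) (hpq : p ∣ q - 1) (hn : 2 ≤ n)
    (G : Type*) [Group G] (hG : Nat.card G = p * q) (hna : ¬ ∀ x y : G, x * y = y * x) :
    ∃ ρ : Representation (ZMod q) (Multiplicative (Fin n → ZMod p))
        (Fin ((n - 1) * (p ^ n - 1)) → ZMod q),
      Nonempty (HomogeneousCover n G ≃*
        Multiplicative (Fin ((n - 1) * (p ^ n - 1)) → ZMod q) ⋊[repMulAut ρ]
          Multiplicative (Fin n → ZMod p)) ∧
      Nat.card {χ : Multiplicative (Fin n → ZMod p) →* (ZMod q)ˣ // χ ≠ 1} = p ^ n - 1 ∧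
      Nonempty (ρ.Equiv (Representation.directSum
        fun i : {χ : Multiplicative (Fin n → ZMod p) →* (ZMod q)ˣ // χ ≠ 1} × Fin (n - 1) =>
          charRep i.1.1)) := by
  have := Fact.mk hp
  have := Fact.mk hq
  obtain ⟨m, rfl⟩ : ∃ m, n = m + 1 := ⟨n - 1, by omega⟩
  have hcop : p.Coprime q := (Nat.coprime_primes hp hq).2 fun h => by
    have := Nat.le_of_dvd (by have := hq.two_le; omega) hpq
    have := hq.two_le; omega
  have hcard := natCard_nontrivial_chars hp hq hpq (m + 1)
  have hfin : Finite (NontrivialChar p q (m + 1)) :=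
    Nat.finite_of_card_ne_zero (by
      rw [hcard]
      exact (Nat.sub_pos_of_lt (Nat.one_lt_pow (Nat.succ_ne_zero m) hp.one_lt)).ne')
  let e : Fin ((m + 1 - 1) * (p ^ (m + 1) - 1)) ≃
      NontrivialChar p q (m + 1) × Fin m :=
    (Finite.equivFinOfCardEq (by rw [Nat.card_prod, hcard, Nat.card_fin, mul_comm]; rfl)).symm
  have hex (χ : NontrivialChar p q (m + 1)) :
      ∃ i, χ.1 (stdGen p (m + 1) i) ≠ 1 := by
    by_contra! h
    exact χ.2 (hom_ext_stdGen h)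
  choose i₀ h₀ using hex
  refine ⟨diagRep fun j => (e j).1.1, ⟨?_⟩, hcard,
    nonempty_diagRep_equiv_directSum e fun i => i.1.1⟩
  exact (QuotientGroup.quotientMulEquivOfEq
    (ker_standardCoverHom e i₀ hp hq hpq (by omega) hG hna h₀).symm).trans
    (QuotientGroup.quotientKerEquivOfSurjective _ (standardCoverHom_surjective e i₀ hcop h₀))
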